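/- Let $L\ge 2$ and let $K=U(2)^{L}$ act on $\mathcal H=(\mathbb C^2)^{\otimes L}$ by $U_1\otimes\dots\otimes U_L$. Let $\mathfrak k=\mathfrak u(2)^{L}$ and $\mathfrak g=\mathfrak{gl}(2)^{L}$ act by $X=\sum_k 1\otimes\dots\otimes X_k\otimes\dots\otimes 1$, and let $(X,Y)=\sum_k\operatorname{tr}(X_k^\dagger Y_k)$. Let $T\subset K$ be the group of diagonal local unitaries. Identify $\eta=((\eta^{(k)}_1,\eta^{(k)}_2))_{k}\in(\mathbb R^2)^L$ with $(\iota\,\mathrm{diag}(\eta^{(k)}_1,\eta^{(k)}_2))_k\in\mathfrak t=\mathrm{Lie}(T)$, and put $\mathfrak t_+=\{\eta:\eta^{(k)}_1\ge\eta^{(k)}_2\ge0\ \forall k\}$. Let $|\lambda\rangle=|1\cdots1\rangle$, with weight $\lambda=((1,0),\dots,(1,0))$, and let $K_\lambda$ be the stabiliser of $\lambda$ under the adjoint action. For a closed subgroup $S\subset K$ with Lie algebra $\mathfrak s$ and $0\neq\Psi\in\mathcal H$, let $\mu_S(\Psi)\in\mathfrak s$ be given by $(\mu_S(\Psi),X)=\frac1\iota\frac{\langle\Psi|X|\Psi\rangle}{\langle\Psi|\Psi\rangle}$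 for all $X\in\mathfrak s$; for a subspace $N\subset\mathcal H$ put $\mu_S(N)=\{\mu_S(\Psi):0\ne\Psi\in N\}$. Let $O^j=\langle X_1\cdots X_j|\lambda\rangle: X_i\in\mathfrak g\rangle_{\mathbb C}$, let $N_2$ be the orthogonal complement of $O^1$ in $O^2$, and let $$P_{K_\lambda}(N_2)=\mu_{K_\lambda}(N_2)\cap(\mathfrak t_\lambda)_+,\qquad P_2=\mathrm{Cone}_\lambda(P_{K_\lambda}(N_2))\cap\mathfrak t_+,\qquad P=\mu_K(\mathcal H)\cap\mathfrak t_+,$$ where $(\mathfrak t_\lambda)_+\subset\mathfrak t$ is the positive Weyl chamber of $K_\lambda$ and $\mathrm{Cone}_\lambda(A)=\{(1-t)\lambda+ta: a\in A,\ t\ge0\}$. For $i<j$ let $\lambda_{i,j}$ be the weight whose components number $i$ and $j$ are $(0,1)$ and whose other components are $(1,0)$. Then: 1. $T$ is a maximal torus of $K$, and $K_\lambda=T$; moreover $T$ is also the set of all $U\in K$ that have $|\lambda\rangle$ as an eigenvector. 2. The weights of $N_2$ are exactly the $\lambda_{i,j}$, $i<j$, and $P_{K_\lambda}(N_2)=\mathrm{conv}\{\lambda_{i,j}:i<j\}$.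 3. $\mathrm{Cone}_\lambda(\mathrm{conv}\{\lambda_{i,j}\})\cap\mathfrak t_+$ is the polytope $$Q=\Big\{\eta\in\mathfrak t_+:\ \eta^{(k)}_1+\eta^{(k)}_2=1,\ \ \eta^{(k)}_2\le\sum_{l\ne k}\eta^{(l)}_2\ \text{ for } 1\le k\le L\Big\}.$$ 4. $P_2=Q$, and the spectral polytope $P$ of the system of $L$ qubits (the ordered local spectra of the one-qubit reduced density matrices of pure states) is also equal to $Q$; hence $P_2=P$. -/

import Mathlib

open scoped Matrix

noncomputable section

namespace Qubits

/-! Systems of `L` qubits. The levels `1, 2` of a qubit are the elements `0, 1` of `Fin 2`. -/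

/-- The Hilbert space `ℂ² ⊗ ⋯ ⊗ ℂ²`, given by coordinates in the product basis. -/
abbrev Hilb (L : ℕ) := EuclideanSpace ℂ (Fin L → Fin 2)

/-- The product basis vector `|s₁⟩ ⊗ ⋯ ⊗ |s_L⟩`. -/
def ket {L : ℕ} (s : Fin L → Fin 2) : Hilb L := EuclideanSpace.single s 1

/-- The group `K = U(2) × ⋯ × U(2)` of local unitaries. -/
abbrev LocalUnitary (L : ℕ) := Fin L → Matrix.unitaryGroup (Fin 2) ℂ

/-- The Lie algebra `𝔤 = 𝔤𝔩(2) ⊕ ⋯ ⊕ 𝔤𝔩(2)`. -/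
abbrev LocalAlg (L : ℕ) := Fin L → Matrix (Fin 2) (Fin 2) ℂ

/-- The action of `K`: the operator `U₁ ⊗ ⋯ ⊗ U_L`. -/
def groupRep {L : ℕ} (U : LocalUnitary L) : Hilb L →ₗ[ℂ] Hilb L :=
  Matrix.toEuclideanLin (Matrix.of fun i j : Fin L → Fin 2 =>
    ∏ k, (U k : Matrix (Fin 2) (Fin 2) ℂ) (i k) (j k))

/-- The derived action of `𝔤`: the operator
`X₁ ⊗ 1 ⊗ ⋯ ⊗ 1 + ⋯ + 1 ⊗ ⋯ ⊗ 1 ⊗ X_L`. -/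
def algRep {L : ℕ} (X : LocalAlg L) : Hilb L →ₗ[ℂ] Hilb L :=
  Matrix.toEuclideanLin (Matrix.of fun i j : Fin L → Fin 2 =>
    ∑ k, X k (i k) (j k) *
      ∏ l ∈ Finset.univ.erase k, (1 : Matrix (Fin 2) (Fin 2) ℂ) (i l) (j l))

/-- The Hilbert–Schmidt product `(X, Y) = tr (X† Y)`, summed over the components. -/
def hilbertSchmidt {L : ℕ} (X Y : LocalAlg L) : ℂ := ∑ k, ((X k)ᴴ * Y k).trace

/-! ### Cartan subalgebra, torus, weights -/

/-- Coordinates `η k a = η^{(k)}_{a}` of the Cartan subalgebra `𝔱 ≃ (ℝ²)^L`. -/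
abbrev Cartan (L : ℕ) := Fin L → Fin 2 → ℝ

/-- The diagonal operators `H_ξ = (diag ξ^{(1)}, …, diag ξ^{(L)})`. -/
def diagOp {L : ℕ} (ξ : Cartan L) : LocalAlg L :=
  fun k => Matrix.diagonal fun a => (ξ k a : ℂ)

/-- The maximal torus `T ⊆ K` of diagonal local unitaries. -/
def torus (L : ℕ) : Subgroup (LocalUnitary L) where
  carrier := {U | ∀ k, (U k : Matrix (Fin 2) (Fin 2) ℂ).IsDiag}
  one_mem' := fun k => by
    simp
  mul_mem' := by
    intro U V hU hV k i j hij
    have h1 := hU k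
    have h2 := hV k
    simp only [Pi.mul_apply, Submonoid.coe_mul, Matrix.mul_apply]
    refine Finset.sum_eq_zero fun a _ => ?_
    by_cases hia : i = a
    · subst hia
      rw [h2 hij, mul_zero]
    · rw [h1 hia, zero_mul]
  inv_mem' := by
    intro U hU k
    exact (hU k).conjTranspose

/-- A torus in `K`: a compact connected commutative subgroup. -/
def IsTorus {L : ℕ} (S : Subgroup (LocalUnitary L)) : Prop :=
  IsCompact (S : Set (LocalUnitary L)) ∧ IsConnected (S : Set (LocalUnitary L)) ∧
    ∀ U ∈ S, ∀ V ∈ S, U * V = V * U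

/-- A maximal torus in `K`. -/
def IsMaximalTorus {L : ℕ} (S : Subgroup (LocalUnitary L)) : Prop :=
  Maximal IsTorus S

/-- `Supp(N)`: the weights `η` of a subspace `N`, i.e. those for which there is `0 ≠ v ∈ N` with
`H_ξ v = (η, ξ) v` for all `ξ`. -/
def weightSupport {L : ℕ} (N : Submodule ℂ (Hilb L)) : Set (Cartan L) :=
  {η | ∃ v ∈ N, v ≠ 0 ∧
    ∀ ξ : Cartan L, algRep (diagOp ξ) v = ((∑ k, ∑ a, η k a * ξ k a : ℝ) : ℂ) • v}

/-- The weight of a product basis vector: `(1,0)` at the sites with `s k = 0` and `(0,1)` at the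
sites with `s k = 1`. -/
def basisWeight {L : ℕ} (s : Fin L → Fin 2) : Cartan L := fun k a => if s k = a then 1 else 0

/-- The highest weight vector `|λ⟩ = |1⟩ ⊗ ⋯ ⊗ |1⟩`. -/
def highestKet (L : ℕ) : Hilb L := ket fun _ => 0

/-- The highest weight `λ = ((1,0), …, (1,0))`. -/
def highestWeight (L : ℕ) : Cartan L := basisWeight fun _ => 0

/-- The two-flip weight `λ_{i,j}`: `(0,1)` at the sites `i` and `j`, and `(1,0)` elsewhere. -/
def twoFlipWeight {L : ℕ} (i j : Fin L) : Cartan L :=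
  basisWeight fun k => if k = i ∨ k = j then 1 else 0

/-- The set of all two-flip weights `λ_{i,j}`, `i < j`. -/
def twoFlipWeights (L : ℕ) : Set (Cartan L) :=
  {η | ∃ i j : Fin L, i < j ∧ η = twoFlipWeight i j}

/-- The stabiliser `K_η` of `η ∈ 𝔱` under the adjoint action, i.e. the centraliser of `H_η`. -/
def stabiliser {L : ℕ} (η : Cartan L) : Subgroup (LocalUnitary L) where
  carrier := {U | ∀ k, Commute (U k : Matrix (Fin 2) (Fin 2) ℂ) (diagOp η k)}
  one_mem' := fun _ => Commute.one_left _
  mul_mem' := fun hU hV k => (hU k).mul_left (hV k)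
  inv_mem' := by
    intro U hU k
    have h := (hU k).star_star
    have hd : star (diagOp η k) = diagOp η k := by
      ext a b
      by_cases hab : a = b
      · subst hab
        simp [diagOp, Matrix.star_apply]
      · simp [diagOp, Matrix.star_apply, hab, Ne.symm hab]
    rw [hd] at h
    exact h

/-- The projective stabiliser `K_{[Ψ]}`: the local unitaries for which `Ψ` is an eigenvector. -/
def projStabiliser {L : ℕ} (Ψ : Hilb L) : Set (LocalUnitary L) :=
  {U | ∃ c : ℂ, groupRep U Ψ = c • Ψ}

/-! ### Lie algebras of subgroups, roots, Weyl chambers -/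

/-- The Lie algebra of a closed subgroup `S` of `K`: the antihermitian `X` with `exp (tX) ∈ S` for
all real `t`. -/
def lieAlg {L : ℕ} (S : Subgroup (LocalUnitary L)) : Set (LocalAlg L) :=
  {X | (∀ k, (X k)ᴴ = -X k) ∧
    ∀ t : ℝ, ∃ U ∈ S, ∀ k, (U k : Matrix (Fin 2) (Fin 2) ℂ) = NormedSpace.exp (t • X k)}

/-- The positive root operator `E_{1,2} = |1⟩⟨2|` at the site `k`; it belongs to the positive root
`η ↦ η k 0 - η k 1`. All positive roots of `𝔤` are of this form. -/
def rootOp {L : ℕ} (k : Fin L) : LocalAlg L := Pi.single k (Matrix.single 0 1 1)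

/-- The positive Weyl chamber of a closed subgroup `S` of `K` that contains `T`: it is cut out by
those positive roots whose root operators lie in the complexified Lie algebra of `S`. -/
def weylChamber {L : ℕ} (S : Subgroup (LocalUnitary L)) : Set (Cartan L) :=
  {η | ∀ k, rootOp k ∈ Submodule.span ℂ (lieAlg S) → η k 1 ≤ η k 0}

/-- The positive chamber `𝔱₊` of `K`: ordered nonnegative local spectra
`η^{(k)}_1 ≥ η^{(k)}_2 ≥ 0`. -/
def posChamber (L : ℕ) : Set (Cartan L) := {η | ∀ k, η k 1 ≤ η k 0 ∧ 0 ≤ η k 1}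

/-! ### Momentum map -/

/-- `M = μ_S(Ψ)`: the element `M` of the Lie algebra of `S` with
`(M, X) = (1/i) ⟨Ψ|X|Ψ⟩ / ⟨Ψ|Ψ⟩` for all `X` in the Lie algebra of `S`. -/
def IsMomentum {L : ℕ} (S : Subgroup (LocalUnitary L)) (Ψ : Hilb L) (M : LocalAlg L) : Prop :=
  M ∈ lieAlg S ∧ ∀ X ∈ lieAlg S,
    hilbertSchmidt M X = (1 / Complex.I) * (inner ℂ Ψ (algRep X Ψ) / inner ℂ Ψ Ψ)

/-- The momentum image `μ_S(N)` of a subspace `N`. -/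
def momentumImage {L : ℕ} (S : Subgroup (LocalUnitary L)) (N : Submodule ℂ (Hilb L)) :
    Set (LocalAlg L) :=
  {M | ∃ Ψ ∈ N, Ψ ≠ 0 ∧ IsMomentum S Ψ M}

/-- The part of the momentum image `μ_S(N)` in `𝔱`, where `η` stands for `i H_η ∈ 𝔱`. -/
def cartanImage {L : ℕ} (S : Subgroup (LocalUnitary L)) (N : Submodule ℂ (Hilb L)) :
    Set (Cartan L) :=
  {η | Complex.I • diagOp η ∈ momentumImage S N}

/-- The spectral polytope `P(ℋ) = μ_K(ℋ) ∩ 𝔱₊`. -/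
def spectralPolytope (L : ℕ) : Set (Cartan L) := cartanImage ⊤ ⊤ ∩ posChamber L

/-! ### Excitation spaces and the polytope from doubly excited states -/

/-- The osculating space `O^j`, spanned by the vectors `X₁ ⋯ X_j |λ⟩` with `X₁, …, X_j ∈ 𝔤`. -/
def osculating (L j : ℕ) : Submodule ℂ (Hilb L) :=
  Submodule.span ℂ {v | ∃ X : Fin j → LocalAlg L,
    v = (List.ofFn fun m => (algRep (X m) : Module.End ℂ (Hilb L))).prod (highestKet L)}

/-- The `j`-excitation space `N_j`: the orthogonal complement of `O^{j-1}` in `O^j`, and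
`N_0 = O^0`. -/
def excitation (L : ℕ) : ℕ → Submodule ℂ (Hilb L)
  | 0 => osculating L 0
  | j + 1 => (osculating L j)ᗮ ⊓ osculating L (j + 1)

/-- `P_{K_λ}(N₂) = μ_{K_λ}(N₂) ∩ (𝔱_λ)₊`. -/
def doublyExcitedMomentum (L : ℕ) : Set (Cartan L) :=
  cartanImage (stabiliser (highestWeight L)) (excitation L 2) ∩
    weylChamber (stabiliser (highestWeight L))

/-- `Cone_v(S)`: the union of all rays that begin at `v` and meet `S`. -/
def coneAt {L : ℕ} (v : Cartan L) (S : Set (Cartan L)) : Set (Cartan L) :=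
  {η | ∃ s ∈ S, ∃ t : ℝ, 0 ≤ t ∧ η = (1 - t) • v + t • s}

/-- `P₂(ℋ) = Cone_λ(P_{K_λ}(N₂)) ∩ 𝔱₊`. -/
def doublyExcitedPolytope (L : ℕ) : Set (Cartan L) :=
  coneAt (highestWeight L) (doublyExcitedMomentum L) ∩ posChamber L

/-- The polytope of the normalised `η ∈ 𝔱₊` with `η^{(k)}_2 ≤ ∑_{l ≠ k} η^{(l)}_2` for all `k`. -/
def polygonPolytope (L : ℕ) : Set (Cartan L) :=
  {η | η ∈ posChamber L ∧ (∀ k, η k 0 + η k 1 = 1) ∧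
    ∀ k, η k 1 ≤ ∑ l ∈ Finset.univ.erase k, η l 1}

end Qubits

end

/-! Everything reduces to sets of configurations `s` in `{0,1}^L`, each carrying the set `excited s`
of sites in state 1. Since `(1,0)` has distinct entries, the centraliser of the highest weight is
the torus, which has no roots, so its chamber is all of `𝔱`. The space `O^j` is spanned by the kets
with at most `j` excited sites, hence `N_2` by those with exactly two (`excitation_succ_eq`).

Testing a momentum in `𝔱` against diagonal operators shows that it is the average of the weights of
`s` with probabilities proportional to `|Ψ_s|²`. Conversely, the vector with amplitudes `√(p s)` has
momentum `∑ p_s · weight(s)` as soon as no one-site operator of the Lie algebra links two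
configurations of the support (`convexHull_subset_cartanImage`). For the torus this always holds;
for `K` it holds when all configurations have even excitation number.

Necessity of the polygon inequalities for `P` is Cauchy–Schwarz applied to the vanishing
off-diagonal entry of a reduced density matrix, followed by a union bound. Sufficiency rests on
`mem_convexHull_evenBits`: points satisfying them are averages of even configurations, by induction
on the number of qubits, merging two of them into one.

Finally, an even set of excited sites splits into pairs, so its weight lies in the cone over the
two-flip weights. Thus `Q ⊆ conv(even weights) ⊆ Cone`. The reverse inclusion inside `𝔱₊` holds
because the polygon inequalities are homogeneous in the second coordinates, which vanish at the
highest weight. -/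

noncomputable section

namespace Qubits

variable {L : ℕ}

/-! ### The torus -/

/-- The diagonal local unitary with prescribed phases. -/
def phaseUnitary (z : Fin L → Fin 2 → Circle) : LocalUnitary L := fun k =>
  ⟨Matrix.diagonal fun a => (z k a : ℂ), by
    rw [Matrix.mem_unitaryGroup_iff, Matrix.star_eq_conjTranspose,
      Matrix.diagonal_conjTranspose, Matrix.diagonal_mul_diagonal, ← Matrix.diagonal_one]
    congr 1
    funext a
    simp [Complex.mul_conj]⟩

theorem continuous_phaseUnitary : Continuous (phaseUnitary (L := L)) := by
  refine continuous_pi fun k => Continuous.subtype_mk ?_ _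
  refine Continuous.matrix_diagonal ?_
  fun_prop

theorem range_phaseUnitary :
    Set.range (phaseUnitary (L := L)) = (torus L : Set (LocalUnitary L)) := by
  ext U
  constructor
  · rintro ⟨z, rfl⟩ k
    exact Matrix.isDiag_diagonal _
  · intro hU
    have key : ∀ k a, ‖(U k : Matrix (Fin 2) (Fin 2) ℂ) a a‖ = 1 := by
      intro k a
      have h := congrFun (congrFun (Matrix.mem_unitaryGroup_iff.1 (U k).2) a) a
      have hd := hU k
      rw [Matrix.mul_apply, Finset.sum_eq_single a] at h
      · rw [Matrix.star_apply, Matrix.one_apply_eq, RCLike.star_def, Complex.mul_conj] at h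
        have h2 : Complex.normSq ((U k : Matrix (Fin 2) (Fin 2) ℂ) a a) = 1 := by
          exact_mod_cast h
        rw [Complex.normSq_eq_norm_sq] at h2
        exact (pow_eq_one_iff_of_nonneg (norm_nonneg _) two_ne_zero).1 h2
      · intro b _ hb
        rw [hd (Ne.symm hb), zero_mul]
      · simp
    refine ⟨fun k a => ⟨(U k : Matrix (Fin 2) (Fin 2) ℂ) a a,
      mem_sphere_zero_iff_norm.2 (key k a)⟩, ?_⟩
    funext k
    apply Subtype.ext
    exact (hU k).diagonal_diag

/-- A matrix that commutes with a diagonal matrix with distinct entries is diagonal. -/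
theorem isDiag_of_commute_diagonal {A : Matrix (Fin 2) (Fin 2) ℂ} {d : Fin 2 → ℂ}
    (hd : d 0 ≠ d 1) (h : Commute A (Matrix.diagonal d)) : A.IsDiag := by
  intro i j hij
  have h1 := congrFun (congrFun h.eq i) j
  rw [Matrix.mul_diagonal, Matrix.diagonal_mul] at h1
  have hne : d j - d i ≠ 0 := by
    rw [sub_ne_zero]
    fin_cases i <;> fin_cases j
    exacts [absurd rfl hij, hd.symm, hd, absurd rfl hij]
  have h2 : A i j * (d j - d i) = 0 := by rw [mul_sub, h1]; ring
  exact (mul_eq_zero.1 h2).resolve_right hne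

theorem commute_of_isDiag {A B : Matrix (Fin 2) (Fin 2) ℂ} (hA : A.IsDiag)
    (hB : B.IsDiag) : Commute A B := by
  rw [← hA.diagonal_diag, ← hB.diagonal_diag]
  exact Matrix.commute_diagonal _ _

theorem isTorus_torus : IsTorus (torus L) := by
  refine ⟨?_, ?_, ?_⟩
  · rw [← range_phaseUnitary]
    exact isCompact_range continuous_phaseUnitary
  · rw [← range_phaseUnitary]
    exact isConnected_range continuous_phaseUnitary
  · intro U hU V hV
    funext k
    exact Subtype.ext (commute_of_isDiag (hU k) (hV k)).eq

theorem isMaximalTorus_torus : IsMaximalTorus (torus L) := by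
  refine ⟨isTorus_torus, fun S hS hTS U hU k => ?_⟩
  -- One torus element with distinct phases at every site suffices: whatever commutes with `diag(1,
  -- -1)` is diagonal.
  let z : Fin L → Fin 2 → Circle := fun _ a => if a = 0 then 1 else -1
  have hz : phaseUnitary z ∈ S := hTS (by
    rw [← SetLike.mem_coe, ← range_phaseUnitary]
    exact ⟨z, rfl⟩)
  have h := congrArg Subtype.val (congrFun (hS.2.2 U hU _ hz) k)
  refine isDiag_of_commute_diagonal (d := fun a => (z k a : ℂ)) ?_ h
  simp only [z]
  norm_num

theorem stabiliser_highestWeight : stabiliser (highestWeight L) = torus L := by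
  ext U
  constructor
  · intro h k
    exact isDiag_of_commute_diagonal (by simp [highestWeight, basisWeight]) (h k)
  · intro h k
    exact commute_of_isDiag (h k) (Matrix.isDiag_diagonal _)

theorem groupRep_ket (U : LocalUnitary L) (t s : Fin L → Fin 2) :
    groupRep U (ket t) s = ∏ k, (U k : Matrix (Fin 2) (Fin 2) ℂ) (s k) (t k) := by
  simp [groupRep, ket, Matrix.toLpLin_apply]

/-- The second row is `(0, u)` with `u ≠ 0`, and orthogonality to the first row kills the remaining
off-diagonal entry. -/
theorem unitary_isDiag_of_lower_eq_zero (U : Matrix.unitaryGroup (Fin 2) ℂ)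
    (h : (U : Matrix (Fin 2) (Fin 2) ℂ) 1 0 = 0) :
    (U : Matrix (Fin 2) (Fin 2) ℂ).IsDiag := by
  have h1 := congrFun (congrFun (Matrix.mem_unitaryGroup_iff.1 U.2) 1) 0
  have h2 := congrFun (congrFun (Matrix.mem_unitaryGroup_iff.1 U.2) 1) 1
  simp only [Matrix.mul_apply, Fin.sum_univ_two, Matrix.star_apply, h, zero_mul, zero_add,
    Matrix.one_apply_eq] at h1 h2
  rw [Matrix.one_apply_ne (by decide)] at h1
  have h11 : (U : Matrix (Fin 2) (Fin 2) ℂ) 1 1 ≠ 0 := by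
    intro h0
    simp [h0] at h2
  have h01 := star_eq_zero.1 ((mul_eq_zero.1 h1).resolve_left h11)
  intro i j hij
  fin_cases i <;> fin_cases j <;> simp_all

theorem projStabiliser_highestKet :
    projStabiliser (highestKet L) = (torus L : Set (LocalUnitary L)) := by
  ext U
  constructor
  · rintro ⟨c, hc⟩ k
    apply unitary_isDiag_of_lower_eq_zero
    by_contra hk
    have hcol : ∀ l, ∃ a, (U l : Matrix (Fin 2) (Fin 2) ℂ) a 0 ≠ 0 := by
      intro l
      by_contra! hl
      have h := congrFun (congrFun (Matrix.mem_unitaryGroup_iff'.1 (U l).2) 0) 0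
      simp [Matrix.mul_apply, hl] at h
    choose s hs using hcol
    -- Columns of a unitary are nonzero, so `s` picks a nonvanishing entry at each site. Forcing the
    -- value 1 at `k` gives a nonzero coordinate of the image away from the highest ket.
    let t : Fin L → Fin 2 := Function.update s k 1
    have ht : groupRep U (highestKet L) t ≠ 0 := by
      rw [highestKet, groupRep_ket, Finset.prod_ne_zero_iff]
      intro l _
      by_cases hl : l = k
      · subst hl
        simpa [t] using hk
      · simpa [t, hl] using hs l
    apply ht
    rw [hc]
    have h0 : t ≠ fun _ => 0 := fun h => by
      have := congrFun h k
      simp [t] at this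
    simp [highestKet, ket, h0]
  · intro hU
    refine ⟨∏ k, (U k : Matrix (Fin 2) (Fin 2) ℂ) 0 0, ?_⟩
    ext s
    rw [highestKet, groupRep_ket]
    by_cases hs : s = fun _ => 0
    · subst hs
      simp [ket]
    · obtain ⟨k, hk⟩ := Function.ne_iff.1 hs
      rw [Finset.prod_eq_zero (Finset.mem_univ k) (hU k hk)]
      simp [ket, hs]

/-! ### Lie algebras -/

theorem mem_lieAlg_top {X : LocalAlg L} : X ∈ lieAlg ⊤ ↔ ∀ k, (X k)ᴴ = -X k := by
  refine ⟨fun h => h.1, fun h => ⟨h, fun t => ?_⟩⟩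
  refine ⟨fun k => ⟨NormedSpace.exp (t • X k), ?_⟩, trivial, fun k => rfl⟩
  rw [Matrix.mem_unitaryGroup_iff, Matrix.star_eq_conjTranspose, ← Matrix.exp_conjTranspose,
    Matrix.conjTranspose_smul, h k, star_trivial, smul_neg, Matrix.exp_neg]
  exact Matrix.mul_nonsing_inv _ ((Matrix.isUnit_iff_isUnit_det _).1 (Matrix.isUnit_exp _))

/-- Differentiate an off-diagonal entry of `exp (tA)` at `t = 0`. The norm chosen inside only serves
to make sense of the derivative. -/
theorem isDiag_of_isDiag_exp {A : Matrix (Fin 2) (Fin 2) ℂ}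
    (h : ∀ t : ℝ, (NormedSpace.exp (t • A)).IsDiag) : A.IsDiag := by
  intro i j hij
  let _ : NormedRing (Matrix (Fin 2) (Fin 2) ℂ) := Matrix.linftyOpNormedRing
  let _ : NormedAlgebra ℝ (Matrix (Fin 2) (Fin 2) ℂ) := Matrix.linftyOpNormedAlgebra
  have h1 := hasDerivAt_exp_smul_const (𝕂 := ℝ) A (0 : ℝ)
  rw [zero_smul, NormedSpace.exp_zero, one_mul] at h1
  let e : Matrix (Fin 2) (Fin 2) ℂ →L[ℝ] ℂ :=
    LinearMap.toContinuousLinearMap (Matrix.entryLinearMap ℝ ℂ i j)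
  have h2 : HasDerivAt (fun t : ℝ => (NormedSpace.exp (t • A)) i j) (A i j) 0 :=
    e.hasFDerivAt.comp_hasDerivAt (0 : ℝ) h1
  have h3 : (fun t : ℝ => (NormedSpace.exp (t • A)) i j) = fun _ => 0 := by
    funext t
    exact h t hij
  rw [h3] at h2
  exact h2.unique (hasDerivAt_const _ _)

theorem mem_lieAlg_torus {X : LocalAlg L} :
    X ∈ lieAlg (torus L) ↔ ∀ k, (X k)ᴴ = -X k ∧ (X k).IsDiag := by
  constructor
  · intro h k
    refine ⟨h.1 k, isDiag_of_isDiag_exp fun t => ?_⟩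
    obtain ⟨U, hU, hX⟩ := h.2 t
    rw [← hX k]
    exact hU k
  · intro h
    refine ⟨fun k => (h k).1, fun t => ?_⟩
    obtain ⟨U, -, hX⟩ := (mem_lieAlg_top.2 fun k => (h k).1).2 t
    refine ⟨U, fun k => ?_, hX⟩
    rw [hX k, ← (h k).2.diagonal_diag, ← Matrix.diagonal_smul, Matrix.exp_diagonal]
    exact Matrix.isDiag_diagonal _

theorem I_smul_diagOp_mem_lieAlg_torus (ξ : Cartan L) :
    Complex.I • diagOp ξ ∈ lieAlg (torus L) := by
  refine mem_lieAlg_torus.2 fun k => ⟨?_, ?_⟩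
  · ext a b
    by_cases h : a = b
    · subst h
      simp [diagOp]
    · simp [diagOp, h, Ne.symm h]
  · intro a b hab
    simp [diagOp, hab]

theorem lieAlg_mono {S S' : Subgroup (LocalUnitary L)} (h : S ≤ S') : lieAlg S ⊆ lieAlg S' :=
  fun _ hX => ⟨hX.1, fun t => (hX.2 t).imp fun _ hU => ⟨h hU.1, hU.2⟩⟩

/-- The complexified Lie algebra of the torus consists of diagonal matrices and so contains no root
operator: no inequality is imposed. -/
theorem weylChamber_torus : weylChamber (torus L) = Set.univ := by
  refine Set.eq_univ_of_forall fun η k hk => ?_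
  exfalso
  have h : ∀ X ∈ Submodule.span ℂ (lieAlg (torus L)), X k 0 1 = 0 := by
    intro X hX
    induction hX using Submodule.span_induction with
    | mem X hX => exact (mem_lieAlg_torus.1 hX k).2 (by decide)
    | zero => rfl
    | add X Y _ _ hX hY => simp [hX, hY]
    | smul c X _ hX => simp [hX]
  simpa [rootOp] using h _ hk

/-! ### The derived action in coordinates -/

theorem algRep_apply (X : LocalAlg L) (Ψ : Hilb L) (s : Fin L → Fin 2) :
    algRep X Ψ s = ∑ k, ∑ a, X k (s k) a * Ψ (Function.update s k a) := by
  have h0 : algRep X Ψ s = ∑ t, (∑ k, X k (s k) (t k) *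
      ∏ l ∈ Finset.univ.erase k, (1 : Matrix (Fin 2) (Fin 2) ℂ) (s l) (t l)) * Ψ t := by
    simp [algRep, Matrix.toLpLin_apply, Matrix.mulVec, dotProduct]
  rw [h0]
  simp_rw [Finset.sum_mul]
  rw [Finset.sum_comm]
  refine Finset.sum_congr rfl fun k _ => ?_
  refine (Finset.sum_of_injOn (fun a => Function.update s k a)
    ((Function.update_injective s k).injOn) (by simp) ?_ ?_).symm
  · intro t _ ht
    have : ∃ l ∈ Finset.univ.erase k, s l ≠ t l := by
      by_contra! hl
      refine ht ⟨t k, by simp, ?_⟩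
      funext l
      by_cases hlk : l = k
      · subst hlk
        simp
      · simp [hlk, hl l (by simp [hlk])]
    obtain ⟨l, hl, hst⟩ := this
    have h1 : ∏ l ∈ Finset.univ.erase k, (1 : Matrix (Fin 2) (Fin 2) ℂ) (s l) (t l) = 0 :=
      Finset.prod_eq_zero hl (Matrix.one_apply_ne hst)
    rw [h1, mul_zero, zero_mul]
  · intro a _
    rw [Function.update_self, Finset.prod_eq_one, mul_one]
    intro l hl
    rw [Function.update_of_ne (Finset.ne_of_mem_erase hl), Matrix.one_apply_eq]

theorem algRep_diagOp_apply (ξ : Cartan L) (Ψ : Hilb L) (s : Fin L → Fin 2) :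
    algRep (diagOp ξ) Ψ s = ((∑ k, ξ k (s k) : ℝ) : ℂ) * Ψ s := by
  rw [algRep_apply, Complex.ofReal_sum, Finset.sum_mul]
  refine Finset.sum_congr rfl fun k _ => ?_
  rw [Finset.sum_eq_single (s k)]
  · simp [diagOp]
  · intro a _ ha
    simp [diagOp, Ne.symm ha]
  · simp

theorem algRep_single_apply (k : Fin L) (A : Matrix (Fin 2) (Fin 2) ℂ) (Ψ : Hilb L)
    (s : Fin L → Fin 2) :
    algRep (Pi.single k A) Ψ s = ∑ a, A (s k) a * Ψ (Function.update s k a) := by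
  rw [algRep_apply, Finset.sum_eq_single k]
  · simp
  · intro l _ hl
    simp [hl]
  · simp

theorem sum_basisWeight_mul (s : Fin L → Fin 2) (ξ : Cartan L) :
    ∑ k, ∑ a, basisWeight s k a * ξ k a = ∑ k, ξ k (s k) := by
  simp [basisWeight]

theorem ket_apply (s t : Fin L → Fin 2) : ket s t = if t = s then 1 else 0 := by
  simp [ket]

theorem eq_sum_smul_ket (Ψ : Hilb L) : Ψ = ∑ s, Ψ s • ket s := by
  ext t
  simp [ket_apply]

/-! ### Excitation spaces -/

/-- The sites in the excited state. -/
def excited (s : Fin L → Fin 2) : Finset (Fin L) := {k | s k = 1}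

theorem mem_excited {s : Fin L → Fin 2} {k : Fin L} : k ∈ excited s ↔ s k = 1 := by
  simp [excited]

theorem excited_update_zero (s : Fin L → Fin 2) (k : Fin L) :
    excited (Function.update s k 0) = (excited s).erase k := by
  ext l
  by_cases h : l = k
  · subst h
    simp [mem_excited]
  · simp [mem_excited, h]

theorem excited_update_one (s : Fin L → Fin 2) (k : Fin L) :
    excited (Function.update s k 1) = insert k (excited s) := by
  ext l
  by_cases h : l = k
  · subst h
    simp [mem_excited]
  · simp [mem_excited, h]

theorem eq_zero_of_excited_eq_empty {s : Fin L → Fin 2} (h : excited s = ∅) :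
    s = fun _ => 0 := by
  funext k
  have : k ∉ excited s := by simp [h]
  rw [mem_excited] at this
  omega

/-- The span of the basis vectors `ket s`, `s ∈ A`. -/
def supportedOn (A : Set (Fin L → Fin 2)) : Submodule ℂ (Hilb L) where
  carrier := {Ψ | ∀ s, Ψ s ≠ 0 → s ∈ A}
  add_mem' := by
    intro Ψ Φ hΨ hΦ s hs
    by_cases h : Ψ s = 0
    · exact hΦ s fun h' => hs (by simp [h, h'])
    · exact hΨ s h
  zero_mem' := by simp
  smul_mem' := by
    intro c Ψ hΨ s hs
    exact hΨ s fun h => hs (by simp [h])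

theorem mem_supportedOn {A : Set (Fin L → Fin 2)} {Ψ : Hilb L} :
    Ψ ∈ supportedOn A ↔ ∀ s, Ψ s ≠ 0 → s ∈ A := Iff.rfl

theorem ket_mem_supportedOn {A : Set (Fin L → Fin 2)} {s : Fin L → Fin 2} (hs : s ∈ A) :
    ket s ∈ supportedOn A := by
  intro t ht
  rw [ket_apply] at ht
  simp only [ne_eq, ite_eq_right_iff, one_ne_zero, imp_false, not_not] at ht
  exact ht ▸ hs

theorem supportedOn_le {A : Set (Fin L → Fin 2)} {N : Submodule ℂ (Hilb L)}
    (h : ∀ s ∈ A, ket s ∈ N) : supportedOn A ≤ N := by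
  intro Ψ hΨ
  rw [eq_sum_smul_ket Ψ]
  refine N.sum_mem fun s _ => ?_
  by_cases hs : Ψ s = 0
  · rw [hs, zero_smul]
    exact N.zero_mem
  · exact N.smul_mem _ (h s (hΨ s hs))

theorem algRep_mem_osculating {j : ℕ} (X : LocalAlg L) {Ψ : Hilb L}
    (hΨ : Ψ ∈ osculating L j) : algRep X Ψ ∈ osculating L (j + 1) := by
  induction hΨ using Submodule.span_induction with
  | mem Ψ h =>
    obtain ⟨Y, rfl⟩ := h
    refine Submodule.subset_span ⟨Fin.cons X Y, ?_⟩
    rw [List.ofFn_succ]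
    simp
  | zero => simp
  | add Ψ Φ _ _ h h' => rw [map_add]; exact add_mem h h'
  | smul c Ψ _ h => rw [map_smul]; exact Submodule.smul_mem _ _ h

theorem algRep_mem_supportedOn_le {m : ℕ} (X : LocalAlg L) {Ψ : Hilb L}
    (hΨ : Ψ ∈ supportedOn {s | (excited s).card ≤ m}) :
    algRep X Ψ ∈ supportedOn {s | (excited s).card ≤ m + 1} := by
  intro s hs
  rw [algRep_apply] at hs
  obtain ⟨k, -, hk⟩ := Finset.exists_ne_zero_of_sum_ne_zero hs
  obtain ⟨a, -, ha⟩ := Finset.exists_ne_zero_of_sum_ne_zero hk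
  have h1 : (excited (Function.update s k a)).card ≤ m := hΨ _ (right_ne_zero_of_mul ha)
  have h2 : excited s ⊆ insert k (excited (Function.update s k a)) := by
    intro l hl
    by_cases h : l = k
    · simp [h]
    · simp only [Finset.mem_insert, h, false_or]
      rw [mem_excited] at hl ⊢
      simpa [h] using hl
  exact (Finset.card_le_card h2).trans ((Finset.card_insert_le _ _).trans (by omega))

theorem ket_mem_osculating (hL : 0 < L) (j : ℕ) (s : Fin L → Fin 2)
    (hs : (excited s).card ≤ j) : ket s ∈ osculating L j := by
  induction j generalizing s with
  | zero =>
    have h : s = fun _ => 0 :=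
      eq_zero_of_excited_eq_empty (Finset.card_eq_zero.1 (Nat.le_zero.1 hs))
    subst h
    exact Submodule.subset_span ⟨Fin.elim0, by simp [highestKet]⟩
  | succ j ih =>
    obtain h | ⟨k, hk⟩ := (excited s).eq_empty_or_nonempty
    -- The identity matrix at a single site acts as the identity operator, so the highest ket stays
    -- in every `O^j`. This needs at least one site.
    · have h1 : algRep (Pi.single (⟨0, hL⟩ : Fin L) 1) (ket s) = ket s := by
        ext t
        rw [algRep_single_apply, Finset.sum_eq_single (t ⟨0, hL⟩)]
        · simp
        · intro a _ ha
          rw [Matrix.one_apply_ne (Ne.symm ha), zero_mul]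
        · simp
      rw [← h1]
      exact algRep_mem_osculating _ (ih s (by simp [h]))
    -- The lowering operator at an excited site `k` recovers `ket s` from a ket with one excitation
    -- fewer.
    · have h1 : algRep (Pi.single k (Matrix.single 1 0 1)) (ket (Function.update s k 0)) =
          ket s := by
        have hk1 := mem_excited.1 hk
        ext t
        rw [algRep_single_apply, Fin.sum_univ_two]
        simp only [ket_apply, Matrix.single_apply]
        by_cases hts : t = s
        · subst hts
          simp [hk1]
        · simp only [hts, if_false]
          by_cases htk : t k = 1
          · have : Function.update t k 0 ≠ Function.update s k 0 := by
              intro h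
              apply hts
              funext l
              by_cases hl : l = k
              · rw [hl, htk, hk1]
              · simpa [hl] using congrFun h l
            simp [this]
          · simp [Ne.symm htk]
      rw [← h1]
      refine algRep_mem_osculating _ (ih _ ?_)
      rw [excited_update_zero, Finset.card_erase_of_mem hk]
      omega

theorem osculating_eq (hL : 0 < L) (j : ℕ) :
    osculating L j = supportedOn {s | (excited s).card ≤ j} := by
  refine le_antisymm (Submodule.span_le.2 ?_)
    (supportedOn_le fun s hs => ket_mem_osculating hL j s hs)
  rintro Ψ ⟨X, rfl⟩
  induction j with
  | zero =>
    simpa [highestKet] using ket_mem_supportedOn (by simp [excited])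
  | succ j ih =>
    rw [List.ofFn_succ, List.prod_cons]
    exact algRep_mem_supportedOn_le _ (ih fun m => X m.succ)

theorem inner_ket (s : Fin L → Fin 2) (Ψ : Hilb L) : inner ℂ (ket s) Ψ = Ψ s := by
  simp [ket, EuclideanSpace.inner_single_left]

theorem orthogonal_supportedOn (A : Set (Fin L → Fin 2)) :
    (supportedOn A)ᗮ = supportedOn Aᶜ := by
  ext Ψ
  rw [Submodule.mem_orthogonal]
  constructor
  · intro h s hs hsA
    exact hs (by rw [← inner_ket]; exact h _ (ket_mem_supportedOn hsA))
  · intro h Φ hΦ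
    rw [PiLp.inner_apply]
    refine Finset.sum_eq_zero fun s _ => ?_
    by_cases h1 : Φ s = 0
    · simp [h1]
    · by_cases h2 : Ψ s = 0
      · simp [h2]
      · exact absurd (hΦ s h1) (h s h2)

theorem excitation_succ_eq (hL : 0 < L) (j : ℕ) :
    excitation L (j + 1) = supportedOn {s | (excited s).card = j + 1} := by
  rw [excitation, osculating_eq hL, osculating_eq hL, orthogonal_supportedOn]
  ext Ψ
  simp only [Submodule.mem_inf, mem_supportedOn, ← forall_and, Set.mem_compl_iff,
    Set.mem_ofPred_eq]
  refine forall_congr' fun s => imp_congr_right fun _ => ?_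
  omega

/-! ### Weights -/

theorem twoFlipWeights_eq :
    twoFlipWeights L = basisWeight '' {s | (excited s).card = 2} := by
  ext η
  constructor
  · rintro ⟨i, j, hij, rfl⟩
    refine ⟨_, ?_, rfl⟩
    have : excited (fun k => if k = i ∨ k = j then 1 else 0) = {i, j} := by
      ext k
      simp [mem_excited, or_iff_not_imp_left]
    rw [Set.mem_ofPred_eq, this, Finset.card_pair hij.ne]
  · rintro ⟨s, hs, rfl⟩
    obtain ⟨i, j, hij, h⟩ := Finset.card_eq_two.1 hs
    have key : ∀ i j, excited s = {i, j} → basisWeight s = twoFlipWeight i j := by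
      intro i j h
      rw [twoFlipWeight]
      congr 1
      funext k
      have : s k = 1 ↔ k = i ∨ k = j := by
        rw [← mem_excited, h]
        simp
      split_ifs with hk
      · exact this.2 hk
      · have := mt this.1 hk
        omega
    rcases lt_or_gt_of_ne hij with h' | h'
    · exact ⟨i, j, h', key i j h⟩
    · exact ⟨j, i, h', key j i (by rw [h, Finset.pair_comm])⟩

theorem cartan_ext_of_forall_sum {η θ : Cartan L}
    (h : ∀ ξ : Cartan L, ∑ k, ∑ a, η k a * ξ k a = ∑ k, ∑ a, θ k a * ξ k a) : η = θ := by
  funext k a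
  have := h (Pi.single k (Pi.single a 1))
  simpa [Pi.single_apply, ite_apply, Finset.sum_ite_eq] using this

/-- Diagonal operators act diagonally on kets, so at any nonzero coordinate `s` of a weight vector
the eigenvalue must be that of `ket s`. -/
theorem weightSupport_supportedOn (A : Set (Fin L → Fin 2)) :
    weightSupport (supportedOn A) = basisWeight '' A := by
  ext η
  constructor
  · rintro ⟨Ψ, hΨ, h0, h⟩
    obtain ⟨s, hs⟩ : ∃ s, Ψ s ≠ 0 := by
      by_contra! h'
      exact h0 (by ext s; simp [h'])
    refine ⟨s, hΨ s hs, cartan_ext_of_forall_sum fun ξ => ?_⟩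
    have h1 := congrArg (fun v : Hilb L => v s) (h ξ)
    simp only [algRep_diagOp_apply, PiLp.smul_apply, smul_eq_mul] at h1
    rw [sum_basisWeight_mul]
    exact Complex.ofReal_injective (mul_right_cancel₀ hs h1)
  · rintro ⟨s, hs, rfl⟩
    refine ⟨ket s, ket_mem_supportedOn hs, ?_, fun ξ => ?_⟩
    · intro h
      have := congrArg (fun v : Hilb L => v s) h
      simp [ket_apply] at this
    · ext t
      rw [algRep_diagOp_apply, PiLp.smul_apply, smul_eq_mul, sum_basisWeight_mul, ket_apply]
      by_cases h : t = s
      · rw [h]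
      · simp [h]

/-! ### Momenta in the Cartan subalgebra -/

theorem mem_convexHull_image_iff {ι E : Type*} [Fintype ι] [DecidableEq ι] [AddCommGroup E]
    [Module ℝ E] (f : ι → E) (A : Set ι) (x : E) :
    x ∈ convexHull ℝ (f '' A) ↔
      ∃ p : ι → ℝ, (∀ i, 0 ≤ p i) ∧ ∑ i, p i = 1 ∧ (∀ i, p i ≠ 0 → i ∈ A) ∧
        x = ∑ i, p i • f i := by
  constructor
  · revert x
    refine convexHull_min ?_ ?_
    · rintro _ ⟨i, hi, rfl⟩
      refine ⟨Pi.single i 1, fun j => ?_, by simp, fun j hj => ?_, ?_⟩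
      · by_cases h : j = i
        · subst h
          simp
        · simp [h]
      · by_cases h : j = i
        · exact h ▸ hi
        · simp [h] at hj
      · simp [Pi.single_apply]
    · rintro _ ⟨p, hp, hp1, hpA, rfl⟩ _ ⟨q, hq, hq1, hqA, rfl⟩ a b ha hb hab
      refine ⟨fun i => a * p i + b * q i,
        fun i => add_nonneg (mul_nonneg ha (hp i)) (mul_nonneg hb (hq i)), ?_, fun i hi => ?_, ?_⟩
      · rw [Finset.sum_add_distrib, ← Finset.mul_sum, ← Finset.mul_sum, hp1, hq1, mul_one,
          mul_one, hab]
      · by_cases h : p i = 0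
        · exact hqA i fun h' => hi (by simp [h, h'])
        · exact hpA i h
      · simp only [add_smul, mul_smul, Finset.sum_add_distrib, Finset.smul_sum]
  · rintro ⟨p, hp, hp1, hpA, rfl⟩
    rw [← Finset.sum_filter_ne_zero] at hp1
    have h : ∑ i, p i • f i = ∑ i with p i ≠ 0, p i • f i := by
      refine (Finset.sum_filter_of_ne (p := fun i => p i ≠ 0) fun i _ hi h => hi ?_).symm
      rw [h, zero_smul]
    rw [h]
    refine (convex_convexHull ℝ _).sum_mem (fun i _ => hp i) hp1 fun i hi => ?_
    exact subset_convexHull ℝ _ ⟨i, hpA i (Finset.mem_filter.1 hi).2, rfl⟩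

theorem algRep_smul (c : ℂ) (X : LocalAlg L) (Ψ : Hilb L) :
    algRep (c • X) Ψ = c • algRep X Ψ := by
  ext s
  simp only [PiLp.smul_apply, algRep_apply, Finset.mul_sum, Pi.smul_apply, Matrix.smul_apply,
    smul_eq_mul, mul_assoc]

/-- The adjoint in the Hilbert–Schmidt product turns `i` into `-i = 1/i`, which cancels the
prefactor in the definition of the momentum. -/
theorem isMomentum_I_smul_diagOp_iff {S : Subgroup (LocalUnitary L)} (hS : torus L ≤ S)
    (Ψ : Hilb L) (η : Cartan L) :
    IsMomentum S Ψ (Complex.I • diagOp η) ↔ ∀ X ∈ lieAlg S,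
      ∑ k, ∑ a, (η k a : ℂ) * X k a a = inner ℂ Ψ (algRep X Ψ) / inner ℂ Ψ Ψ := by
  have h1 : ∀ X : LocalAlg L, hilbertSchmidt (Complex.I • diagOp η) X =
      (1 / Complex.I) * ∑ k, ∑ a, (η k a : ℂ) * X k a a := by
    intro X
    rw [hilbertSchmidt, Finset.mul_sum]
    refine Finset.sum_congr rfl fun k _ => ?_
    rw [Matrix.trace, Finset.mul_sum]
    refine Finset.sum_congr rfl fun a _ => ?_
    simp [diagOp, Matrix.diagonal_conjTranspose, Matrix.diagonal_mul]
  have hI : (1 / Complex.I : ℂ) ≠ 0 := by simp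
  constructor
  · intro h X hX
    have h2 := h.2 X hX
    rw [h1] at h2
    exact mul_left_cancel₀ hI h2
  · intro h
    refine ⟨lieAlg_mono hS (I_smul_diagOp_mem_lieAlg_torus η), fun X hX => ?_⟩
    rw [h1, h X hX]

theorem inner_self_eq_sum (Ψ : Hilb L) : inner ℂ Ψ Ψ = ((∑ s, ‖Ψ s‖ ^ 2 : ℝ) : ℂ) := by
  rw [inner_self_eq_norm_sq_to_K, ← EuclideanSpace.norm_sq_eq, Complex.ofReal_pow]
  rfl

theorem sum_norm_sq_pos {Ψ : Hilb L} (h : Ψ ≠ 0) : 0 < ∑ s, ‖Ψ s‖ ^ 2 := by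
  rw [← EuclideanSpace.norm_sq_eq]
  exact pow_pos (norm_pos_iff.2 h) 2

theorem inner_algRep (X : LocalAlg L) (Ψ : Hilb L) :
    inner ℂ Ψ (algRep X Ψ) = ∑ s, ∑ k, ∑ a,
      X k (s k) a * (star (Ψ s) * Ψ (Function.update s k a)) := by
  rw [PiLp.inner_apply]
  refine Finset.sum_congr rfl fun s _ => ?_
  rw [algRep_apply, RCLike.inner_apply, Finset.sum_mul]
  refine Finset.sum_congr rfl fun k _ => ?_
  rw [Finset.sum_mul]
  refine Finset.sum_congr rfl fun a _ => ?_
  simp only [RCLike.star_def]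
  ring

theorem sum_smul_basisWeight_apply (p : (Fin L → Fin 2) → ℝ) (k : Fin L) (a : Fin 2) :
    (∑ s, p s • basisWeight s) k a = ∑ s, if s k = a then p s else 0 := by
  simp [Finset.sum_apply, basisWeight]

theorem sum_sum_smul_basisWeight_mul (p : (Fin L → Fin 2) → ℝ) (X : LocalAlg L) :
    ∑ k, ∑ a, (((∑ s, p s • basisWeight s) k a : ℝ) : ℂ) * X k a a =
      ∑ s, (p s : ℂ) * ∑ k, X k (s k) (s k) := by
  simp only [Finset.mul_sum]
  conv_rhs => rw [Finset.sum_comm]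
  refine Finset.sum_congr rfl fun k _ => ?_
  simp only [sum_smul_basisWeight_apply, Complex.ofReal_sum, Finset.sum_mul]
  rw [Finset.sum_comm]
  refine Finset.sum_congr rfl fun s _ => ?_
  rw [Finset.sum_eq_single (s k)]
  · simp
  · intro a _ ha
    simp [Ne.symm ha]
  · simp

theorem eq_sum_of_isMomentum {S : Subgroup (LocalUnitary L)} (hS : torus L ≤ S)
    {Ψ : Hilb L} {η : Cartan L} (h : IsMomentum S Ψ (Complex.I • diagOp η)) :
    η = ∑ s, (‖Ψ s‖ ^ 2 / ∑ t, ‖Ψ t‖ ^ 2) • basisWeight s := by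
  refine cartan_ext_of_forall_sum fun ξ => ?_
  have h1 := (isMomentum_I_smul_diagOp_iff hS Ψ η).1 h _
    (lieAlg_mono hS (I_smul_diagOp_mem_lieAlg_torus ξ))
  rw [algRep_smul, inner_smul_right, inner_self_eq_sum] at h1
  have h2 : inner ℂ Ψ (algRep (diagOp ξ) Ψ) =
      ((∑ s, ‖Ψ s‖ ^ 2 * ∑ k, ξ k (s k) : ℝ) : ℂ) := by
    rw [PiLp.inner_apply, Complex.ofReal_sum]
    refine Finset.sum_congr rfl fun s _ => ?_
    rw [algRep_diagOp_apply, RCLike.inner_apply, mul_assoc, RCLike.mul_conj, Complex.ofReal_mul,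
      mul_comm]
    simp
  have h3 : ∑ k, ∑ a, (η k a : ℂ) * (Complex.I • diagOp ξ : LocalAlg L) k a a =
      Complex.I * ((∑ k, ∑ a, η k a * ξ k a : ℝ) : ℂ) := by
    simp only [Complex.ofReal_sum, Finset.mul_sum]
    refine Finset.sum_congr rfl fun k _ => Finset.sum_congr rfl fun a _ => ?_
    simp [diagOp]
    ring
  rw [h2, h3, mul_div_assoc] at h1
  have h4 := mul_left_cancel₀ Complex.I_ne_zero h1
  rw [← Complex.ofReal_div] at h4
  have h5 := sum_sum_smul_basisWeight_mul (fun s => ‖Ψ s‖ ^ 2 / ∑ t, ‖Ψ t‖ ^ 2) (diagOp ξ)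
  have h6 : ∑ k, ∑ a, (∑ s, (‖Ψ s‖ ^ 2 / ∑ t, ‖Ψ t‖ ^ 2) • basisWeight s) k a * ξ k a =
      ∑ s, (‖Ψ s‖ ^ 2 / ∑ t, ‖Ψ t‖ ^ 2) * ∑ k, ξ k (s k) := by
    simp only [diagOp, Matrix.diagonal_apply_eq] at h5
    exact_mod_cast h5
  rw [Complex.ofReal_injective h4, h6, Finset.sum_div]
  refine Finset.sum_congr rfl fun s _ => ?_
  ring

theorem cartanImage_supportedOn_subset {S : Subgroup (LocalUnitary L)} (hS : torus L ≤ S)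
    (A : Set (Fin L → Fin 2)) :
    cartanImage S (supportedOn A) ⊆ convexHull ℝ (basisWeight '' A) := by
  rintro η ⟨Ψ, hΨ, h0, h⟩
  rw [mem_convexHull_image_iff]
  refine ⟨_, fun s => by positivity, ?_, fun s hs => hΨ s ?_, eq_sum_of_isMomentum hS h⟩
  · rw [← Finset.sum_div]
    exact div_self (sum_norm_sq_pos h0).ne'
  · intro h'
    simp [h'] at hs

/-- Take amplitudes `√(p s)`. In the expectation of `X` the diagonal terms give the weighted
average, and the cross terms join configurations of `A` that differ at one site, where `hA` makes
the matrix entry of `X` vanish. -/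
theorem convexHull_subset_cartanImage {S : Subgroup (LocalUnitary L)} (hS : torus L ≤ S)
    {A : Set (Fin L → Fin 2)}
    (hA : ∀ X ∈ lieAlg S, ∀ s ∈ A, ∀ k a, a ≠ s k → Function.update s k a ∈ A →
      X k (s k) a = 0) :
    convexHull ℝ (basisWeight '' A) ⊆ cartanImage S (supportedOn A) := by
  intro η hη
  obtain ⟨p, hp, hp1, hpA, rfl⟩ := (mem_convexHull_image_iff _ _ _).1 hη
  let Ψ : Hilb L := WithLp.toLp 2 fun s => ((√(p s) : ℝ) : ℂ)
  have hΨ : ∀ s, Ψ s = ((√(p s) : ℝ) : ℂ) := fun s => rfl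
  have hsupp : ∀ s, Ψ s ≠ 0 → s ∈ A := fun s hs => hpA s fun h => hs (by simp [hΨ, h])
  have hnorm : inner ℂ Ψ Ψ = 1 := by
    rw [inner_self_eq_sum]
    simp [hΨ, Real.sq_sqrt (hp _), hp1]
  refine ⟨Ψ, hsupp, ?_, (isMomentum_I_smul_diagOp_iff hS _ _).2 fun X hX => ?_⟩
  · intro h
    rw [h, inner_zero_left] at hnorm
    exact zero_ne_one hnorm
  · rw [hnorm, div_one, inner_algRep, sum_sum_smul_basisWeight_mul]
    refine Finset.sum_congr rfl fun s _ => ?_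
    rw [Finset.mul_sum]
    refine Finset.sum_congr rfl fun k _ => ?_
    rw [Finset.sum_eq_single (s k)]
    · rw [Function.update_eq_self, hΨ, RCLike.star_def, Complex.conj_ofReal,
        ← Complex.ofReal_mul, Real.mul_self_sqrt (hp s), mul_comm]
    · intro a _ ha
      by_cases h1 : Ψ s = 0
      · simp [h1]
      by_cases h2 : Ψ (Function.update s k a) = 0
      · simp [h2]
      rw [hA X hX s (hsupp s h1) k a ha (hsupp _ h2), zero_mul]
    · simp

theorem doublyExcitedMomentum_eq (hL : 0 < L) :
    doublyExcitedMomentum L = convexHull ℝ (twoFlipWeights L) := by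
  rw [doublyExcitedMomentum, stabiliser_highestWeight, weylChamber_torus, Set.inter_univ,
    twoFlipWeights_eq, excitation_succ_eq hL 1]
  refine (cartanImage_supportedOn_subset le_rfl _).antisymm
    (convexHull_subset_cartanImage le_rfl fun X hX s _ k a ha _ => ?_)
  exact (mem_lieAlg_torus.1 hX k).2 ha.symm

theorem cartanImage_mono (S : Subgroup (LocalUnitary L)) {N N' : Submodule ℂ (Hilb L)}
    (h : N ≤ N') : cartanImage S N ⊆ cartanImage S N' :=
  fun _ ⟨Ψ, hΨ, h'⟩ => ⟨Ψ, h hΨ, h'⟩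

/-- Superpositions of basis states of even excitation number have diagonal reduced density
matrices. -/
theorem convexHull_even_subset_cartanImage :
    convexHull ℝ (basisWeight '' {s : Fin L → Fin 2 | Even (excited s).card}) ⊆
      cartanImage ⊤ ⊤ := by
  refine (convexHull_subset_cartanImage le_top fun X _ s hs k a ha h => ?_).trans
    (cartanImage_mono _ le_top)
  -- Flipping one site changes parity, so two even configurations never differ at exactly one site.
  exfalso
  have key : ∀ s : Fin L → Fin 2, ∀ k, s k = 1 → Even (excited s).card →
      ¬ Even (excited (Function.update s k 0)).card := by
    intro s k hk hs h
    have hk' : k ∈ excited s := mem_excited.2 hk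
    rw [excited_update_zero, Finset.card_erase_of_mem hk'] at h
    have := Finset.card_pos.2 ⟨k, hk'⟩
    grind
  obtain h1 | h1 : s k = 1 ∨ s k = 0 := by omega
  · have h2 : a = 0 := by omega
    subst h2
    exact key s k h1 hs h
  · have h2 : a = 1 := by omega
    subst h2
    refine key _ k (by simp) h ?_
    rw [Function.update_idem, ← h1, Function.update_eq_self]
    exact hs

/-! ### Polygon inequalities for pure states -/

theorem sum_eq_sum_update {M : Type*} [AddCommMonoid M] (k : Fin L)
    (f : (Fin L → Fin 2) → M) :
    ∑ s, f s = ∑ s with s k = 0, (f s + f (Function.update s k 1)) := by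
  rw [Finset.sum_add_distrib, ← Finset.sum_filter_add_sum_filter_not _ fun s => s k = 0]
  congr 1
  refine (Finset.sum_nbij' (fun s => Function.update s k 1) (fun s => Function.update s k 0)
    ?_ ?_ ?_ ?_ fun _ _ => rfl).symm
  · intro s _
    simp
  · intro s _
    simp
  · intro s hs
    rw [Finset.mem_filter] at hs
    rw [Function.update_idem, ← hs.2, Function.update_eq_self]
  · intro s hs
    rw [Finset.mem_filter] at hs
    have : s k = 1 := by omega
    rw [Function.update_idem, ← this, Function.update_eq_self]

/-- The off-diagonal entries of the reduced density matrices vanish at a momentum in `𝔱`. -/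
theorem sum_star_mul_update_eq_zero {Ψ : Hilb L} (h0 : Ψ ≠ 0) {η : Cartan L}
    (h : IsMomentum ⊤ Ψ (Complex.I • diagOp η)) (k : Fin L) :
    ∑ s with s k = 0, star (Ψ s) * Ψ (Function.update s k 1) = 0 := by
  -- Test against the antihermitian matrix with off-diagonal entries `b`, `c` at site `k`. The
  -- choices `b = 1` and `b = i` together separate the sum from its conjugate.
  have key : ∀ b c : ℂ, star b = -c →
      b * ∑ s with s k = 0, star (Ψ s) * Ψ (Function.update s k 1) +
      c * ∑ s with s k = 0, star (Ψ (Function.update s k 1)) * Ψ s = 0 := by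
    intro b c hbc
    have hX : (Pi.single k !![0, b; c, 0] : LocalAlg L) ∈ lieAlg ⊤ := by
      refine mem_lieAlg_top.2 fun l => ?_
      by_cases hl : l = k
      · subst hl
        have hcb : star c = -b := by rw [← neg_eq_iff_eq_neg.2 hbc, star_neg, star_star]
        ext i j
        rw [Pi.single_eq_same]
        fin_cases i <;> fin_cases j <;> simp_all
      · simp [hl]
    have h1 := (isMomentum_I_smul_diagOp_iff le_top Ψ η).1 h _ hX
    have h2 : inner ℂ Ψ Ψ ≠ 0 := inner_self_ne_zero.2 h0
    rw [Finset.sum_eq_zero, eq_comm, div_eq_zero_iff, or_iff_left h2] at h1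
    · rw [PiLp.inner_apply, sum_eq_sum_update k] at h1
      rw [Finset.mul_sum, Finset.mul_sum, ← Finset.sum_add_distrib, ← h1]
      refine Finset.sum_congr rfl fun s hs => ?_
      rw [Finset.mem_filter] at hs
      have h3 : Function.update s k 0 = s := by rw [← hs.2, Function.update_eq_self]
      simp only [algRep_single_apply, Fin.sum_univ_two, RCLike.inner_apply, hs.2, h3,
        Function.update_self, Function.update_idem, RCLike.star_def]
      simp
      ring
    · intro l _
      refine Finset.sum_eq_zero fun a _ => ?_
      by_cases hl : l = k
      · subst hl
        fin_cases a <;> simp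
      · simp [hl]
  have h1 := key 1 (-1) (by simp)
  have h2 := key Complex.I Complex.I (by simp)
  have h3 := mul_left_cancel₀ Complex.I_ne_zero
    ((mul_add _ _ _).trans (h2.trans (mul_zero Complex.I).symm))
  linear_combination (1 / 2 : ℂ) * h1 + (1 / 2 : ℂ) * h3

/-- Expanding the hypothesis gives `Aβ ≤ B(A - α) ≤ A(A - α)`; then divide by `A`. -/
theorem add_le_of_mul_le_sub_mul_sub {A B α β : ℝ} (hαA : α ≤ A)
    (hβB : β ≤ B) (hBA : B ≤ A) (h : α * β ≤ (A - α) * (B - β)) : α + β ≤ A := by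
  by_contra! hlt
  have hA : 0 < A := by
    by_contra! hA
    linarith
  have h1 : A * β ≤ B * (A - α) := by linarith [mul_comm A β]
  have h2 : B * (A - α) ≤ A * (A - α) := mul_le_mul_of_nonneg_right hBA (by linarith)
  have h3 : β ≤ A - α := le_of_mul_le_mul_left (h1.trans h2) hA
  linarith

/-- Let `A`, `B` be the masses with `s k = 0` and `s k = 1`, and `α`, `β` the parts of them where
all other sites are 0. Cauchy–Schwarz turns `horth` into `αβ ≤ (A - α)(B - β)`, so `α + β ≤ A`, that
is, `B ≤ (A - α) + (B - β)`. The right side is the mass where some site other than `k` is excited,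
which a union bound controls. -/
theorem sum_sq_update_le_of_orthogonal (k : Fin L) (c : (Fin L → Fin 2) → ℝ)
    (horth : c (fun _ => 0) * c (Function.update (fun _ => 0) k 1) ≤
      ∑ s ∈ (Finset.univ.filter fun s : Fin L → Fin 2 => s k = 0).erase (fun _ => 0),
        c s * c (Function.update s k 1))
    (hc : ∀ s, 0 ≤ c s)
    (hle : ∑ s with s k = 0, c (Function.update s k 1) ^ 2 ≤ ∑ s with s k = 0, c s ^ 2) :
    ∑ s with s k = 0, c (Function.update s k 1) ^ 2 ≤
      ∑ l ∈ Finset.univ.erase k, ∑ s, if s l = 1 then c s ^ 2 else 0 := by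
  have hmem : (fun _ => 0 : Fin L → Fin 2) ∈
      Finset.univ.filter fun s : Fin L → Fin 2 => s k = 0 := by simp
  have hA := Finset.add_sum_erase _ (fun s => c s ^ 2) hmem
  have hB := Finset.add_sum_erase _ (fun s => c (Function.update s k 1) ^ 2) hmem
  set T := (Finset.univ.filter fun s : Fin L → Fin 2 => s k = 0).erase (fun _ => 0) with hT
  have hcs := Finset.sum_mul_sq_le_sq_mul_sq T c fun s => c (Function.update s k 1)
  have hA0 : 0 ≤ ∑ s ∈ T, c s ^ 2 := Finset.sum_nonneg fun s _ => sq_nonneg _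
  have hB0 : 0 ≤ ∑ s ∈ T, c (Function.update s k 1) ^ 2 :=
    Finset.sum_nonneg fun s _ => sq_nonneg _
  have hsq := pow_le_pow_left₀ (mul_nonneg (hc _) (hc _)) horth 2
  have h1 := add_le_of_mul_le_sub_mul_sub (A := ∑ s with s k = 0, c s ^ 2)
    (B := ∑ s with s k = 0, c (Function.update s k 1) ^ 2)
    (α := c (fun _ => 0) ^ 2) (β := c (Function.update (fun _ => 0) k 1) ^ 2)
    (by linarith) (by linarith) hle (by
      rw [← hA, ← hB, add_sub_cancel_left, add_sub_cancel_left, ← mul_pow]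
      exact hsq.trans hcs)
  -- The union bound: every configuration counted on the left has an excited site `l ≠ k`.
  have h2 : ∑ s ∈ T, (c s ^ 2 + c (Function.update s k 1) ^ 2) ≤
      ∑ l ∈ Finset.univ.erase k, ∑ s, if s l = 1 then c s ^ 2 else 0 := by
    rw [Finset.sum_comm, sum_eq_sum_update k]
    refine (Finset.sum_le_sum fun s hs => ?_).trans (Finset.sum_le_sum_of_subset_of_nonneg
      (Finset.erase_subset _ _) fun s _ _ => ?_)
    · obtain ⟨hs0, hs⟩ := Finset.mem_erase.1 hs
      have hsk := (Finset.mem_filter.1 hs).2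
      obtain ⟨l, hl⟩ := Function.ne_iff.1 hs0
      have hl1 : s l = 1 := by omega
      have hlk : l ≠ k := by
        rintro rfl
        exact hl hsk
      have hle : l ∈ Finset.univ.erase k := by simp [hlk]
      refine add_le_add ?_ ?_
      · refine le_trans ?_ (Finset.single_le_sum (fun m _ => ?_) hle)
        · simp [hl1]
        · split_ifs <;> positivity
      · refine le_trans ?_ (Finset.single_le_sum (fun m _ => ?_) hle)
        · simp [hl1, hlk]
        · split_ifs <;> positivity
    · refine add_nonneg ?_ ?_ <;>
      · refine Finset.sum_nonneg fun m _ => ?_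
        split_ifs <;> positivity
  rw [Finset.sum_add_distrib] at h2
  linarith

theorem spectralPolytope_subset : spectralPolytope L ⊆ polygonPolytope L := by
  rintro η ⟨⟨Ψ, -, h0, h⟩, hη⟩
  have hpos := sum_norm_sq_pos h0
  set n := ∑ s, ‖Ψ s‖ ^ 2 with hn
  let c : (Fin L → Fin 2) → ℝ := fun s => ‖Ψ s‖ / √n
  have hc : ∀ s, c s ^ 2 = ‖Ψ s‖ ^ 2 / n := fun s => by
    rw [div_pow, Real.sq_sqrt hpos.le]
  have hη1 : ∀ k a, η k a = ∑ s, if s k = a then c s ^ 2 else 0 := by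
    intro k a
    rw [eq_sum_of_isMomentum le_top h, sum_smul_basisWeight_apply]
    simp_rw [hc]
    rfl
  have hk0 : ∀ k, η k 0 = ∑ s with s k = 0, c s ^ 2 := by
    intro k
    rw [hη1, Finset.sum_filter]
  have hk1 : ∀ k, η k 1 = ∑ s with s k = 0, c (Function.update s k 1) ^ 2 := by
    intro k
    rw [hη1, sum_eq_sum_update k]
    refine Finset.sum_congr rfl fun s hs => ?_
    simp [(Finset.mem_filter.1 hs).2]
  refine ⟨hη, fun k => ?_, fun k => ?_⟩
  · rw [hk0, hk1, ← Finset.sum_add_distrib, ← sum_eq_sum_update k fun s => c s ^ 2]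
    simp_rw [hc]
    rw [← Finset.sum_div, div_self hpos.ne']
  · have hle := (hη k).1
    rw [hk0, hk1] at hle
    rw [hk1]
    simp_rw [hη1]
    refine sum_sq_update_le_of_orthogonal k c ?_ (fun s => by positivity) hle
    -- Isolate the all-zero term of the vanishing off-diagonal entry and bound its modulus by the
    -- triangle inequality; only moduli remain.
    have horth := sum_star_mul_update_eq_zero h0 h k
    rw [← Finset.add_sum_erase _ _ (show (fun _ => 0 : Fin L → Fin 2) ∈
      Finset.univ.filter fun s : Fin L → Fin 2 => s k = 0 by simp)] at horth
    have h1 := congrArg norm (eq_neg_of_add_eq_zero_left horth)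
    rw [norm_neg, norm_mul, norm_star] at h1
    have h2 := h1.le.trans (norm_sum_le _ _)
    simp only [norm_mul, norm_star] at h2
    have h3 := div_le_div_of_nonneg_right h2 hpos.le
    rw [Finset.sum_div] at h3
    have h4 : ∀ x y : ℝ, x / √n * (y / √n) = x * y / n := fun x y => by
      rw [div_mul_div_comm, Real.mul_self_sqrt hpos.le]
    simpa only [c, h4] using h3

/-! ### Convex hull of the even basis weights -/

/-- The indicator vector of the excited sites. -/
def bits {n : ℕ} (s : Fin n → Fin 2) : Fin n → ℝ := fun k => if s k = 1 then 1 else 0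

/-- The indicator vectors of the sets of sites of even cardinality. -/
def evenBits (n : ℕ) : Set (Fin n → ℝ) := bits '' {s | Even (excited s).card}

theorem card_excited_cons {n : ℕ} (a : Fin 2) (s : Fin n → Fin 2) :
    (excited (Fin.cons a s : Fin (n + 1) → Fin 2)).card =
      (excited s).card + if a = 1 then 1 else 0 := by
  rw [excited, Fin.card_filter_univ_succ]
  simp only [Fin.cons_zero, Fin.cons_succ]
  split_ifs <;> rfl

theorem bits_cons {n : ℕ} (a : Fin 2) (s : Fin n → Fin 2) :
    bits (Fin.cons a s : Fin (n + 1) → Fin 2) = Fin.cons (if a = 1 then 1 else 0) (bits s) := by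
  funext k
  refine Fin.cases ?_ (fun k => ?_) k <;> simp [bits]

/-- Splitting the first coordinate of a vector in the convex hull of the even vectors. -/
theorem split_mem_convexHull_evenBits {n : ℕ} {p q : ℝ} (hp0 : 0 ≤ p) (hp1 : p ≤ 1)
    (hq0 : 0 ≤ q) (hq1 : q ≤ 1) {z : Fin (n + 1) → ℝ} (hz : z ∈ convexHull ℝ (evenBits (n + 1))) :
    (Fin.cons ((1 - z 0) * q + z 0 * p)
      (Fin.cons ((1 - z 0) * q + z 0 * (1 - p)) (Fin.tail z) : Fin (n + 1) → ℝ) :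
        Fin (n + 2) → ℝ) ∈ convexHull ℝ (evenBits (n + 2)) := by
  -- The map is affine in `z`, so vertices suffice. It is a parity-preserving random splitting of
  -- the first bit: 0 becomes `11` with probability `q`, else `00`; 1 becomes `10` with probability
  -- `p`, else `01`.
  refine convexHull_min (s := evenBits (n + 1)) (t := {z | (Fin.cons ((1 - z 0) * q + z 0 * p)
    (Fin.cons ((1 - z 0) * q + z 0 * (1 - p)) (Fin.tail z) : Fin (n + 1) → ℝ) :
        Fin (n + 2) → ℝ) ∈ convexHull ℝ (evenBits (n + 2))}) ?_ ?_ hz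
  · rintro _ ⟨s, hs, rfl⟩
    obtain ⟨b, s, rfl⟩ : ∃ b t, s = Fin.cons b t := ⟨s 0, Fin.tail s, (Fin.cons_self_tail s).symm⟩
    rw [Set.mem_ofPred_eq, card_excited_cons] at hs
    have mem : ∀ c d : Fin 2, Even ((excited s).card + (if d = 1 then 1 else 0) +
        if c = 1 then 1 else 0) → (Fin.cons (if c = 1 then 1 else 0)
          (Fin.cons (if d = 1 then 1 else 0) (bits s) : Fin (n + 1) → ℝ) : Fin (n + 2) → ℝ) ∈
          convexHull ℝ (evenBits (n + 2)) := by
      intro c d h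
      refine subset_convexHull ℝ _ ⟨Fin.cons c (Fin.cons d s : Fin (n + 1) → Fin 2), ?_, ?_⟩
      · rwa [Set.mem_ofPred_eq, card_excited_cons, card_excited_cons]
      · rw [bits_cons, bits_cons]
    obtain rfl | rfl : b = 0 ∨ b = 1 := by omega
    · have h := convex_convexHull ℝ (evenBits (n + 2)) (mem 0 0 (by simpa using hs))
        (mem 1 1 (by simp at hs ⊢; grind)) (sub_nonneg.2 hq1) hq0 (by ring)
      rw [Set.mem_ofPred_eq, bits_cons]
      convert h using 1
      funext k
      refine Fin.cases ?_ (fun k => Fin.cases ?_ (fun k => ?_) k) k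
      · simp
      · simp
      · simp
        ring
    · have h := convex_convexHull ℝ (evenBits (n + 2)) (mem 1 0 (by simpa using hs))
        (mem 0 1 (by simpa using hs)) hp0 (sub_nonneg.2 hp1) (by ring)
      rw [Set.mem_ofPred_eq, bits_cons]
      convert h using 1
      funext k
      refine Fin.cases ?_ (fun k => Fin.cases ?_ (fun k => ?_) k) k
      · simp
      · simp
      · simp
        ring
  · intro z hz w hw a b ha hb hab
    have h := convex_convexHull ℝ (evenBits (n + 2)) hz hw ha hb hab
    rw [Set.mem_ofPred_eq]
    convert h using 1
    obtain rfl : a = 1 - b := by linarith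
    funext k
    refine Fin.cases ?_ (fun k => Fin.cases ?_ (fun k => ?_) k) k
    · simp
      ring
    · simp
      ring
    · simp [Fin.tail]

/-- Induction: replace the first two coordinates `a`, `b` by one coordinate `y` that still meets the
hypotheses, then split `y` back into `a` and `b`. -/
theorem mem_convexHull_evenBits {n : ℕ} (x : Fin (n + 1) → ℝ) (h0 : ∀ k, 0 ≤ x k)
    (h1 : ∀ k, x k ≤ 1 / 2) (h2 : ∀ k, 2 * x k ≤ ∑ l, x l) :
    x ∈ convexHull ℝ (evenBits (n + 1)) := by
  induction n with
  | zero =>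
    refine subset_convexHull ℝ _ ⟨fun _ => 0, by simp [excited], ?_⟩
    funext k
    have h3 := h2 k
    have h4 := h0 k
    obtain rfl : k = 0 := by omega
    rw [Fin.sum_univ_one] at h3
    simp only [bits, zero_ne_one, if_false]
    linarith
  | succ n ih =>
    obtain ⟨a, x, rfl⟩ : ∃ b t, x = Fin.cons b t := ⟨x 0, Fin.tail x, (Fin.cons_self_tail x).symm⟩
    obtain ⟨b, x, rfl⟩ : ∃ b t, x = Fin.cons b t := ⟨x 0, Fin.tail x, (Fin.cons_self_tail x).symm⟩
    simp only [Fin.forall_fin_succ, Fin.cons_zero, Fin.cons_succ, Fin.sum_univ_succ] at h0 h1 h2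
    set σ := ∑ l, x l with hσ
    have hσ0 : 0 ≤ σ := Finset.sum_nonneg fun l _ => h0.2.2 l
    -- Splitting needs `|a - b| ≤ y ≤ a + b`; the induction hypothesis needs `y ≤ 1/2`, `y ≤ σ` and
    -- `2 * x k ≤ y + σ`. The largest `y` allowed by the upper bounds meets the lower ones.
    obtain ⟨y, hy⟩ : ∃ y, y = min (a + b) (min (1 / 2) σ) := ⟨_, rfl⟩
    have hy1 : y ≤ a + b := hy ▸ min_le_left _ _
    have hy2 : y ≤ 1 / 2 := hy ▸ (min_le_right _ _).trans (min_le_left _ _)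
    have hy3 : y ≤ σ := hy ▸ (min_le_right _ _).trans (min_le_right _ _)
    have hy0 : 0 ≤ y := by
      rw [hy]
      exact le_min (add_nonneg h0.1 h0.2.1) (le_min (by norm_num) hσ0)
    have hab : a - b ≤ y := by
      rw [hy]
      refine le_min ?_ (le_min ?_ ?_) <;> linarith [h0.1, h0.2.1, h1.1, h2.1]
    have hba : b - a ≤ y := by
      rw [hy]
      refine le_min ?_ (le_min ?_ ?_) <;> linarith [h0.1, h0.2.1, h1.2.1, h2.2.1]
    have hx : (Fin.cons y x : Fin (n + 1) → ℝ) ∈ convexHull ℝ (evenBits (n + 1)) := by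
      refine ih _ ?_ ?_ ?_ <;> rw [Fin.forall_fin_succ] <;>
        simp only [Fin.cons_zero, Fin.cons_succ, Fin.sum_univ_succ]
      · exact ⟨hy0, h0.2.2⟩
      · exact ⟨hy2, h1.2.2⟩
      · refine ⟨by linarith, fun k => ?_⟩
        have hk : x k ≤ σ := Finset.single_le_sum (fun l _ => h0.2.2 l) (Finset.mem_univ k)
        rw [← hσ, ← sub_le_iff_le_add, hy]
        refine le_min ?_ (le_min ?_ ?_) <;> linarith [h1.2.2 k, h2.2.2 k]
    have hy' : 0 < 1 - y := by linarith
    -- If `y = 0` then `a = b`, and the junk value `(a - b) / 0 = 0` gives the harmless choice `p =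
    -- 1/2`.
    have hyab : y * ((a - b) / y) = a - b := by
      by_cases h : y = 0
      · rw [h] at hab hba ⊢
        linarith
      · field_simp
    have hyq : (1 - y) * ((a + b - y) / (2 * (1 - y))) = (a + b - y) / 2 := by
      field_simp
    have habs : |(a - b) / y| ≤ 1 := by
      rw [abs_div, abs_of_nonneg hy0]
      exact div_le_one_of_le₀ (abs_le.2 ⟨by linarith, hab⟩) hy0
    obtain ⟨hp0, hp1⟩ := abs_le.1 habs
    -- These `p`, `q` solve `y(2p - 1) = a - b` and `2(1 - y)q = a + b - y`, the difference and sum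
    -- of the two split coordinates.
    have h := split_mem_convexHull_evenBits (p := (1 + (a - b) / y) / 2)
      (q := (a + b - y) / (2 * (1 - y))) (by linarith) (by linarith)
      (div_nonneg (by linarith) (by linarith))
      (div_le_one_of_le₀ (by linarith [h1.1, h1.2.1]) (by linarith)) hx
    simp only [Fin.cons_zero, Fin.tail_cons, hyq] at h
    convert h using 2
    · linarith
    · congr 1
      linarith

theorem polygonPolytope_subset_convexHull (hL : 0 < L) :
    polygonPolytope L ⊆ convexHull ℝ (basisWeight '' {s : Fin L → Fin 2 | Even (excited s).card}) := by
  obtain ⟨n, rfl⟩ : ∃ n, L = n + 1 := ⟨L - 1, by omega⟩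
  rintro η ⟨hη, hη1, hη2⟩
  have h := mem_convexHull_evenBits (fun k => η k 1) (fun k => (hη k).2)
    (fun k => by linarith [(hη k).1, hη1 k]) fun k => by
      rw [← Finset.add_sum_erase _ _ (Finset.mem_univ k)]
      linarith [hη2 k]
  rw [evenBits, mem_convexHull_image_iff] at h
  rw [mem_convexHull_image_iff]
  obtain ⟨p, hp, hp1, hpA, hx⟩ := h
  refine ⟨p, hp, hp1, hpA, ?_⟩
  have h1 : ∀ k, η k 1 = ∑ s, if s k = 1 then p s else 0 := by
    intro k
    rw [congrFun hx k]
    simp [bits, Finset.sum_apply]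
  have h0 : ∀ k, η k 0 = ∑ s, if s k = 0 then p s else 0 := by
    intro k
    rw [eq_sub_of_add_eq (hη1 k), h1, ← hp1, ← Finset.sum_sub_distrib]
    refine Finset.sum_congr rfl fun s _ => ?_
    obtain h | h : s k = 0 ∨ s k = 1 := by omega
    all_goals simp [h]
  funext k a
  rw [sum_smul_basisWeight_apply]
  obtain rfl | rfl : a = 0 ∨ a = 1 := by omega
  exacts [h0 k, h1 k]

/-! ### The cone over the two-flip weights -/

/-- Relative to the apex, a cone over a convex set is closed under nonnegative combinations: average
the base points with weights `a * t` and `b * u`. If both weights vanish, the point is the apex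
itself. -/
theorem add_mem_coneAt {v : Cartan L} {S : Set (Cartan L)} (hS : Convex ℝ S) {η θ : Cartan L}
    (hη : η ∈ coneAt v S) (hθ : θ ∈ coneAt v S) {a b : ℝ} (ha : 0 ≤ a) (hb : 0 ≤ b) :
    v + a • (η - v) + b • (θ - v) ∈ coneAt v S := by
  obtain ⟨x, hx, t, ht, rfl⟩ := hη
  obtain ⟨y, hy, u, hu, rfl⟩ := hθ
  have h1 := mul_nonneg ha ht
  have h2 := mul_nonneg hb hu
  obtain h | h := (add_nonneg h1 h2).eq_or_lt
  · refine ⟨x, hx, 0, le_rfl, ?_⟩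
    have h3 : a * t = 0 := by linarith
    have h4 : b * u = 0 := by linarith
    funext k c
    simp only [Pi.add_apply, Pi.smul_apply, Pi.sub_apply, smul_eq_mul]
    linear_combination (x k c - v k c) * h3 + (y k c - v k c) * h4
  · refine ⟨(a * t / (a * t + b * u)) • x + (b * u / (a * t + b * u)) • y,
      hS hx hy (div_nonneg h1 h.le) (div_nonneg h2 h.le) ?_, a * t + b * u, h.le, ?_⟩
    · rw [← add_div, div_self h.ne']
    · funext k c
      simp only [Pi.add_apply, Pi.smul_apply, Pi.sub_apply, smul_eq_mul]
      field_simp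
      ring

theorem convex_coneAt {v : Cartan L} {S : Set (Cartan L)} (hS : Convex ℝ S) :
    Convex ℝ (coneAt v S) := by
  intro η hη θ hθ a b ha hb hab
  convert add_mem_coneAt hS hη hθ ha hb using 1
  obtain rfl : a = 1 - b := by linarith
  module

theorem twoFlipWeights_nonempty (hL : 2 ≤ L) : (twoFlipWeights L).Nonempty :=
  ⟨_, ⟨0, by omega⟩, ⟨1, by omega⟩, by simp, rfl⟩

/-- Displacements from the highest weight add over disjoint sets of excited sites, so excitations
can be removed two at a time. -/
theorem basisWeight_mem_coneAt (hL : 2 ≤ L) (m : ℕ) (s : Fin L → Fin 2)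
    (hs : (excited s).card = m + m) :
    basisWeight s ∈ coneAt (highestWeight L) (convexHull ℝ (twoFlipWeights L)) := by
  induction m generalizing s with
  | zero =>
    obtain ⟨x, hx⟩ := twoFlipWeights_nonempty hL
    refine ⟨x, subset_convexHull ℝ _ hx, 0, le_rfl, ?_⟩
    rw [eq_zero_of_excited_eq_empty (Finset.card_eq_zero.1 hs)]
    simp [highestWeight]
  | succ m ih =>
    obtain ⟨i, hi, j, hj, hij⟩ := Finset.one_lt_card.1 (show 1 < (excited s).card by omega)
    have h1 := ih (Function.update (Function.update s i 0) j 0) (by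
      rw [excited_update_zero, excited_update_zero, Finset.card_erase_of_mem
        (Finset.mem_erase.2 ⟨hij.symm, hj⟩), Finset.card_erase_of_mem hi]
      omega)
    let u : Fin L → Fin 2 := Function.update (Function.update (fun _ => 0) i 1) j 1
    have h2 : basisWeight u ∈ twoFlipWeights L := by
      rw [twoFlipWeights_eq]
      refine ⟨u, ?_, rfl⟩
      have h0 : excited (fun _ => 0 : Fin L → Fin 2) = ∅ := by simp [excited]
      rw [Set.mem_ofPred_eq, excited_update_one, excited_update_one, h0]
      exact Finset.card_pair hij.symm
    have h3 : basisWeight u ∈ coneAt (highestWeight L) (convexHull ℝ (twoFlipWeights L)) :=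
      ⟨_, subset_convexHull ℝ _ h2, 1, zero_le_one, by simp⟩
    convert add_mem_coneAt (convex_convexHull ℝ _) h1 h3 zero_le_one zero_le_one using 1
    funext k a
    rw [mem_excited] at hi hj
    simp only [one_smul, Pi.add_apply, Pi.sub_apply, basisWeight, highestWeight, u]
    by_cases hkj : k = j
    · subst hkj
      simp [hj]
    · by_cases hki : k = i
      · subst hki
        simp [hkj, hi]
      · simp [hkj, hki]

theorem polygonPolytope_subset_coneAt (hL : 2 ≤ L) :
    polygonPolytope L ⊆ coneAt (highestWeight L) (convexHull ℝ (twoFlipWeights L)) := by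
  refine (polygonPolytope_subset_convexHull (by omega)).trans
    (convexHull_min ?_ (convex_coneAt (convex_convexHull ℝ _)))
  rintro _ ⟨s, ⟨m, hm⟩, rfl⟩
  exact basisWeight_mem_coneAt hL m s hm

theorem convexHull_twoFlipWeights_subset :
    convexHull ℝ (twoFlipWeights L) ⊆ {η | (∀ k, η k 0 + η k 1 = 1) ∧
      ∀ k, η k 1 ≤ ∑ l ∈ Finset.univ.erase k, η l 1} := by
  refine convexHull_min ?_ ?_
  · rw [twoFlipWeights_eq]
    rintro _ ⟨s, hs, rfl⟩
    refine ⟨fun k => ?_, fun k => ?_⟩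
    · obtain h | h : s k = 0 ∨ s k = 1 := by omega
      all_goals simp [basisWeight, h]
    · have hnn : ∀ l ∈ Finset.univ.erase k, 0 ≤ basisWeight s l 1 := fun l _ => by
        rw [basisWeight]
        split_ifs <;> norm_num
      by_cases h : s k = 1
      · obtain ⟨l, hl, hlk⟩ := Finset.exists_mem_ne
          (show 1 < (excited s).card by rw [Set.mem_ofPred_eq.mp hs]; norm_num) k
        refine le_trans ?_ (Finset.single_le_sum hnn (Finset.mem_erase.2 ⟨hlk, Finset.mem_univ l⟩))
        simp [basisWeight, h, mem_excited.1 hl]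
      · refine le_trans ?_ (Finset.sum_nonneg hnn)
        simp [basisWeight, h]
  · intro η hη θ hθ a b ha hb hab
    refine ⟨fun k => ?_, fun k => ?_⟩
    · simp only [Pi.add_apply, Pi.smul_apply, smul_eq_mul]
      linear_combination a * hη.1 k + b * hθ.1 k + hab
    · simp only [Pi.add_apply, Pi.smul_apply, smul_eq_mul, Finset.sum_add_distrib,
        ← Finset.mul_sum]
      exact add_le_add (mul_le_mul_of_nonneg_left (hη.2 k) ha)
        (mul_le_mul_of_nonneg_left (hθ.2 k) hb)

theorem coneAt_inter_posChamber (hL : 2 ≤ L) :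
    coneAt (highestWeight L) (convexHull ℝ (twoFlipWeights L)) ∩ posChamber L =
      polygonPolytope L := by
  refine Set.Subset.antisymm ?_ fun η hη => ⟨polygonPolytope_subset_coneAt hL hη, hη.1⟩
  rintro _ ⟨⟨x, hx, t, ht, rfl⟩, hpos⟩
  obtain ⟨h1, h2⟩ := convexHull_twoFlipWeights_subset hx
  refine ⟨hpos, fun k => ?_, fun k => ?_⟩
  · simp only [Pi.add_apply, Pi.smul_apply, smul_eq_mul, highestWeight, basisWeight]
    simp
    linear_combination t * h1 k
  · simp only [Pi.add_apply, Pi.smul_apply, smul_eq_mul, highestWeight, basisWeight]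
    simp only [zero_ne_one, if_false, mul_zero, zero_add, ← Finset.mul_sum]
    -- The apex has vanishing second coordinates, so moving along a ray only scales both sides of
    -- the polygon inequality by `t ≥ 0`.
    exact mul_le_mul_of_nonneg_left (h2 k) ht

theorem spectralPolytope_eq (hL : 2 ≤ L) : spectralPolytope L = polygonPolytope L :=
  spectralPolytope_subset.antisymm fun _ hη =>
    ⟨convexHull_even_subset_cartanImage (polygonPolytope_subset_convexHull (by omega) hη), hη.1⟩

end Qubits

end

theorem mainTheorem4 (L : ℕ) (hL : 2 ≤ L) :
    (Qubits.IsMaximalTorus (Qubits.torus L) ∧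
      Qubits.stabiliser (Qubits.highestWeight L) = Qubits.torus L ∧
      Qubits.projStabiliser (Qubits.highestKet L) = (Qubits.torus L : Set (Qubits.LocalUnitary L))) ∧
    Qubits.weightSupport (Qubits.excitation L 2) = Qubits.twoFlipWeights L ∧
    Qubits.doublyExcitedMomentum L = convexHull ℝ (Qubits.twoFlipWeights L) ∧
    Qubits.coneAt (Qubits.highestWeight L) (convexHull ℝ (Qubits.twoFlipWeights L)) ∩
        Qubits.posChamber L = Qubits.polygonPolytope L ∧
    Qubits.doublyExcitedPolytope L = Qubits.polygonPolytope L ∧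
    Qubits.spectralPolytope L = Qubits.polygonPolytope L := by
  have hL0 : 0 < L := by omega
  refine ⟨⟨Qubits.isMaximalTorus_torus, Qubits.stabiliser_highestWeight,
    Qubits.projStabiliser_highestKet⟩, ?_, Qubits.doublyExcitedMomentum_eq hL0,
    Qubits.coneAt_inter_posChamber hL, ?_, Qubits.spectralPolytope_eq hL⟩
  · rw [Qubits.excitation_succ_eq hL0 1, Qubits.weightSupport_supportedOn,
      Qubits.twoFlipWeights_eq]
  · rw [Qubits.doublyExcitedPolytope, Qubits.doublyExcitedMomentum_eq hL0,
      Qubits.coneAt_inter_posChamber hL]
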